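/- Let $d\ge 1$ and $n\ge 3$ be integers and let $u\in\mathbb C$, $u\neq 0$. For $k\ge 1$ let ${\rm Y}_{d,k}(u)$ be the Yokonuma–Hecke algebra: the associative unital $\mathbb C$-algebra with generators $g_1,\dots,g_{k-1},t_1,\dots,t_k$ and relations $g_ig_j=g_jg_i$ for $|i-j|>1$; $g_{i+1}g_ig_{i+1}=g_ig_{i+1}g_i$; $t_it_j=t_jt_i$; $t_i^d=1$; $g_it_i=t_{i+1}g_i$; $g_it_{i+1}=t_ig_i$; $g_it_j=t_jg_i$ for $j\ne i,i+1$; and $g_i^2=1+(u-1)e_i+(u-1)e_ig_i$, where $e_i=\frac1d\sum_{s=0}^{d-1}t_i^st_{i+1}^{d-s}$. For $1\le i\le n-2$ put $$r_{i,i+1}=\sum_{\substack{a,b,c\in\mathbb Z/d\mathbb Z\\ a+b+c=0}}t_i^at_{i+1}^bt_{i+2}^c\,\bigl(1+g_i+g_{i+1}+g_ig_{i+1}+g_{i+1}g_i+g_ig_{i+1}g_i\bigr)\in{\rm Y}_{d,n}(u),$$ i.e. the sum of the elements $g_x$ over $x$ in the subgroup $\langle t_it_{i+1}^{-1},t_{i+1}t_{i+2}^{-1}\rangle\rtimes\langle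 s_i,s_{i+1}\rangle$ of $(\mathbb Z/d\mathbb Z)^n\rtimes S_n$, and let ${\rm FTL}_{d,n}(u)$ be the quotient of ${\rm Y}_{d,n}(u)$ by the two-sided ideal generated by all the $r_{i,i+1}$. Let $z,x_1,\dots,x_{d-1}\in\mathbb C$, put $x_0=1$, and let $x:\mathbb Z/d\mathbb Z\to\mathbb C$ be the function $k\mapsto x_k$. Let ${\rm tr}$ be Juyumaya's Markov trace with parameters $z,x_1,\dots,x_{d-1}$, i.e. the linear functional ${\rm tr}:\bigcup_{k\ge1}{\rm Y}_{d,k}(u)\to\mathbb C$ such that for all $k\ge 1$ and $a,b\in{\rm Y}_{d,k}(u)$ $${\rm tr}(ab)={\rm tr}(ba),\quad {\rm tr}(1)=1,\quad {\rm tr}(ag_k)=z\,{\rm tr}(a),\quad {\rm tr}(at_{k+1}^s)=x_s\,{\rm tr}(a)\ (1\le s\le d-1).$$ Write $\chi(j)=e^{2\pi i j/d}$ for $j\in\mathbb Z/d\mathbb Z$ and $\widehat x(m)=\sum_{k\in\mathbb Z/d\mathbb Z}x_k\,\chi(-km)$. Then ${\rm tr}$ passes to the quotient, i.e. its restriction to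 ${\rm Y}_{d,n}(u)$ factors through a linear functional on ${\rm FTL}_{d,n}(u)$, if and only if there are disjoint sets ${\rm Sup}_1,{\rm Sup}_2\subseteq\mathbb Z/d\mathbb Z$ whose union is the support of $\widehat x$ such that $$x_k=-z\Bigl(\sum_{m\in{\rm Sup}_1}\chi(km)+(u+1)\sum_{m\in{\rm Sup}_2}\chi(km)\Bigr)\quad\text{for all }k\in\mathbb Z/d\mathbb Z,$$ and $|{\rm Sup}_1|+(u+1)|{\rm Sup}_2|\neq0$ with $$z=-\frac1{|{\rm Sup}_1|+(u+1)|{\rm Sup}_2|}.$$ -/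

import Mathlib

/-- Generators of the Yokonuma–Hecke algebra on `n` strands.  Strands and braiding generators are
numbered from `0`: `t j` is the framing generator of strand `j` and `g i` braids the strands `i` and
`i + 1`. -/
inductive YHGen (n : ℕ) : Type
  | g (i : ℕ) (hi : i + 1 < n) : YHGen n
  | t (j : ℕ) (hj : j < n) : YHGen n

namespace YHFree

/-- The letter `g_i` in the free algebra. -/
noncomputable def g {n : ℕ} (i : ℕ) (hi : i + 1 < n) : FreeAlgebra ℂ (YHGen n) :=
  FreeAlgebra.ι ℂ (YHGen.g i hi)

/-- The letter `t_j` in the free algebra. -/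
noncomputable def t {n : ℕ} (j : ℕ) (hj : j < n) : FreeAlgebra ℂ (YHGen n) :=
  FreeAlgebra.ι ℂ (YHGen.t j hj)

/-- `e_i = (1/d) ∑_{s=0}^{d-1} t_i^s t_{i+1}^{d-s}`. -/
noncomputable def e (d : ℕ) {n : ℕ} (i : ℕ) (hi : i + 1 < n) : FreeAlgebra ℂ (YHGen n) :=
  (1 / (d : ℂ)) • ∑ s ∈ Finset.range d, t i (by omega) ^ s * t (i + 1) hi ^ (d - s)

end YHFree

/-- The defining relations of the Yokonuma–Hecke algebra. -/
inductive YHRel (d n : ℕ) (u : ℂ) : FreeAlgebra ℂ (YHGen n) → FreeAlgebra ℂ (YHGen n) → Prop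
  | g_comm (i j : ℕ) (hi : i + 1 < n) (hj : j + 1 < n) (hij : i + 1 < j ∨ j + 1 < i) :
      YHRel d n u (YHFree.g i hi * YHFree.g j hj) (YHFree.g j hj * YHFree.g i hi)
  | braid (i : ℕ) (hi : i + 1 < n) (hi' : i + 1 + 1 < n) :
      YHRel d n u (YHFree.g (i + 1) hi' * YHFree.g i hi * YHFree.g (i + 1) hi')
        (YHFree.g i hi * YHFree.g (i + 1) hi' * YHFree.g i hi)
  | t_comm (i j : ℕ) (hi : i < n) (hj : j < n) :
      YHRel d n u (YHFree.t i hi * YHFree.t j hj) (YHFree.t j hj * YHFree.t i hi)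
  | t_pow (i : ℕ) (hi : i < n) : YHRel d n u (YHFree.t i hi ^ d) 1
  | g_t_left (i : ℕ) (hi : i + 1 < n) (hi' : i < n) :
      YHRel d n u (YHFree.g i hi * YHFree.t i hi') (YHFree.t (i + 1) hi * YHFree.g i hi)
  | g_t_right (i : ℕ) (hi : i + 1 < n) (hi' : i < n) :
      YHRel d n u (YHFree.g i hi * YHFree.t (i + 1) hi) (YHFree.t i hi' * YHFree.g i hi)
  | g_t_other (i j : ℕ) (hi : i + 1 < n) (hj : j < n) (h : j ≠ i) (h' : j ≠ i + 1) :
      YHRel d n u (YHFree.g i hi * YHFree.t j hj) (YHFree.t j hj * YHFree.g i hi)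
  | quadratic (i : ℕ) (hi : i + 1 < n) :
      YHRel d n u (YHFree.g i hi ^ 2)
        (1 + (u - 1) • YHFree.e d i hi + (u - 1) • (YHFree.e d i hi * YHFree.g i hi))

/-- The Yokonuma–Hecke algebra `Y_{d,n}(u)`, by generators and relations over `ℂ`. -/
abbrev YokonumaHecke (d n : ℕ) (u : ℂ) : Type := RingQuot (YHRel d n u)

namespace YokonumaHecke

variable {d n : ℕ} {u : ℂ}

/-- The generator `g_i` of `Y_{d,n}(u)`. -/
noncomputable def g (i : ℕ) (hi : i + 1 < n) : YokonumaHecke d n u :=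
  RingQuot.mkAlgHom ℂ (YHRel d n u) (YHFree.g i hi)

/-- The generator `t_j` of `Y_{d,n}(u)`. -/
noncomputable def t (j : ℕ) (hj : j < n) : YokonumaHecke d n u :=
  RingQuot.mkAlgHom ℂ (YHRel d n u) (YHFree.t j hj)

/-- Where the generators of `Y_{d,n}(u)` go in `Y_{d,n+1}(u)`. -/
noncomputable def inclGen : YHGen n → YokonumaHecke d (n + 1) u
  | YHGen.g i hi => g i (by omega)
  | YHGen.t j hj => t j (by omega)

theorem lift_inclGen_g (i : ℕ) (hi : i + 1 < n) :
    FreeAlgebra.lift ℂ (inclGen (d := d) (u := u)) (YHFree.g i hi) =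
      RingQuot.mkAlgHom ℂ (YHRel d (n + 1) u) (YHFree.g i (by omega)) := by
  simp [YHFree.g, inclGen, g]

theorem lift_inclGen_t (j : ℕ) (hj : j < n) :
    FreeAlgebra.lift ℂ (inclGen (d := d) (u := u)) (YHFree.t j hj) =
      RingQuot.mkAlgHom ℂ (YHRel d (n + 1) u) (YHFree.t j (by omega)) := by
  simp [YHFree.t, inclGen, t]

theorem lift_inclGen_e (i : ℕ) (hi : i + 1 < n) :
    FreeAlgebra.lift ℂ (inclGen (d := d) (u := u)) (YHFree.e d i hi) =
      RingQuot.mkAlgHom ℂ (YHRel d (n + 1) u) (YHFree.e d i (by omega)) := by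
  simp only [YHFree.e, map_smul, map_sum, map_mul, map_pow, lift_inclGen_t]

theorem lift_inclGen_rel ⦃a b : FreeAlgebra ℂ (YHGen n)⦄ (h : YHRel d n u a b) :
    FreeAlgebra.lift ℂ (inclGen (d := d) (u := u)) a =
      FreeAlgebra.lift ℂ (inclGen (d := d) (u := u)) b := by
  cases h <;>
    simp only [map_mul, map_pow, map_add, map_smul, map_one, lift_inclGen_g, lift_inclGen_t,
      lift_inclGen_e] <;>
    simp only [← map_mul, ← map_pow, ← map_add, ← map_smul,
      ← map_one (RingQuot.mkAlgHom ℂ (YHRel d (n + 1) u))] <;>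
    apply RingQuot.mkAlgHom_rel
  · exact YHRel.g_comm _ _ _ _ ‹_›
  · exact YHRel.braid _ _ _
  · exact YHRel.t_comm _ _ _ _
  · exact YHRel.t_pow _ _
  · exact YHRel.g_t_left _ _ _
  · exact YHRel.g_t_right _ _ _
  · exact YHRel.g_t_other _ _ _ _ ‹_› ‹_›
  · exact YHRel.quadratic _ _

/-- The canonical homomorphism `Y_{d,n}(u) → Y_{d,n+1}(u)` that adds one strand on the right:
`g_i ↦ g_i` and `t_j ↦ t_j`. -/
noncomputable def incl : YokonumaHecke d n u →ₐ[ℂ] YokonumaHecke d (n + 1) u :=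
  RingQuot.liftAlgHom ℂ ⟨FreeAlgebra.lift ℂ inclGen, lift_inclGen_rel⟩

/-- `∑ g_w` over the six elements `w` of the subgroup `⟨s_i, s_{i+1}⟩` of the symmetric group, each
written as a reduced word in `s_i`, `s_{i+1}`. -/
noncomputable def steinberg (i : ℕ) (hi : i + 2 < n) : YokonumaHecke d n u :=
  1 + g i (by omega) + g (i + 1) hi + g i (by omega) * g (i + 1) hi + g (i + 1) hi * g i (by omega)
    + g i (by omega) * g (i + 1) hi * g i (by omega)

/-- The element `r_{i,i+1} = ∑ g_x`, where `x` runs over the subgroup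
`⟨t_i t_{i+1}⁻¹, t_{i+1} t_{i+2}⁻¹⟩ ⋊ ⟨s_i, s_{i+1}⟩` of `(ℤ/d)ⁿ ⋊ S_n`: such an `x` is uniquely
`t_i^a t_{i+1}^b t_{i+2}^c w` with `a + b + c = 0` in `ℤ/d` and `w ∈ ⟨s_i, s_{i+1}⟩`, and then
`g_x = t_i^a t_{i+1}^b t_{i+2}^c g_w`. -/
noncomputable def r [NeZero d] (i : ℕ) (hi : i + 2 < n) : YokonumaHecke d n u :=
  ∑ a : ZMod d, ∑ b : ZMod d, ∑ c : ZMod d,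
    if a + b + c = 0 then
      t i (by omega) ^ a.val * t (i + 1) (by omega) ^ b.val * t (i + 2) hi ^ c.val * steinberg i hi
    else 0

end YokonumaHecke

/-- The two-sided ideal of `Y_{d,n}(u)` generated by all the elements `r_{i,i+1}`. -/
noncomputable def ftlIdeal (d n : ℕ) [NeZero d] (u : ℂ) : TwoSidedIdeal (YokonumaHecke d n u) :=
  TwoSidedIdeal.span {y | ∃ (i : ℕ) (hi : i + 2 < n), y = YokonumaHecke.r i hi}

/-- The framization of the Temperley–Lieb algebra, `FTL_{d,n}(u) = Y_{d,n}(u) / ⟨r_{i,i+1}⟩`. -/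
abbrev FTL (d n : ℕ) [NeZero d] (u : ℂ) : Type := (ftlIdeal d n u).ringCon.Quotient

/-- A linear functional on `Y_{d,n}(u)` passes to the quotient `FTL_{d,n}(u)` if it factors through
the canonical projection. -/
def PassesToFTL {d n : ℕ} [NeZero d] {u : ℂ} (τ : YokonumaHecke d n u →ₗ[ℂ] ℂ) : Prop :=
  ∃ σ : FTL d n u →ₗ[ℂ] ℂ, ∀ a : YokonumaHecke d n u, σ ((ftlIdeal d n u).ringCon.mk' a) = τ a

/-- `tr` is Juyumaya's Markov trace on `⋃_{n ≥ 1} Y_{d,n}(u)` with parameters `z` and `x_s`, `s ≠ 0`: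
a linear functional on the union, given as a family of functionals on the `Y_{d,n}(u)` that is
compatible with the maps `Y_{d,n}(u) → Y_{d,n+1}(u)`, subject to the four inductive rules.  (With
strands numbered from `0`, the last generators of `Y_{d,n+1}(u)` are `t n` and `g (n - 1)`; below
`n = m + 1`.) -/
structure IsJuyumayaTrace (d : ℕ) (u z : ℂ) (x : ZMod d → ℂ)
    (tr : ∀ n : ℕ, YokonumaHecke d n u →ₗ[ℂ] ℂ) : Prop where
  compat : ∀ (m : ℕ) (a : YokonumaHecke d (m + 1) u),
    tr (m + 2) (YokonumaHecke.incl a) = tr (m + 1) a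
  trace : ∀ (m : ℕ) (a b : YokonumaHecke d (m + 1) u), tr (m + 1) (a * b) = tr (m + 1) (b * a)
  unit : ∀ m : ℕ, tr (m + 1) 1 = 1
  markov : ∀ (m : ℕ) (a : YokonumaHecke d (m + 1) u),
    tr (m + 2) (YokonumaHecke.incl a * YokonumaHecke.g m (by omega)) = z * tr (m + 1) a
  framing : ∀ (m : ℕ) (a : YokonumaHecke d (m + 1) u) (s : ZMod d), s ≠ 0 →
    tr (m + 2) (YokonumaHecke.incl a * YokonumaHecke.t (m + 1) (by omega) ^ s.val) =
      x s * tr (m + 1) a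

/-!
The trace passes to the quotient if and only if every `r_{i,i+1}` lies in the radical of the form
`(a, b) ↦ tr (a b)`. The `r_{i,i+1}` are conjugate to each other, so only the first one matters, and
since `Y_{d,n+1}(u)` is spanned over `Y_{d,n}(u)` by elements to which the Markov rules apply, it is
enough to look at the radical on three strands.

There `r = d² ∑ₘ Eₘ S`, where `Eₘ` projects onto the common eigenspace of the three framing
generators for the eigenvalue `χ(m)` and `S` is the sum of the six `g_w`. Each `Eₘ S` spans a left
ideal of dimension at most one, so it lies in the radical if and only if its trace vanishes. With
`c` the `m`-th Fourier coefficient of `x`, this trace is `c (c + z) (c + (u + 1) z)`: on the image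
of `Eₘ` the algebra looks like the Hecke algebra, where `(1 + g)² = (u + 1) (1 + g)`. Hence all
Fourier coefficients of `x` lie in `{0, -z, -(u + 1) z}`; the sets `Sup₁` and `Sup₂` are the places
of the two nonzero values, Fourier inversion gives the formula for `x_k`, and `x₀ = 1` gives the one
for `z`.
-/

section KerCore

variable {k R M : Type*} [CommRing k] [Ring R] [Algebra k R] [AddCommGroup M] [Module k M]

/-- The largest two-sided ideal on which the linear map `τ` vanishes. When `τ` is a trace it is the
radical of the bilinear form `(a, b) ↦ τ (a * b)`. -/
def kerCore (τ : R →ₗ[k] M) : TwoSidedIdeal R :=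
  TwoSidedIdeal.mk' {a | ∀ b c, τ (b * a * c) = 0}
    (fun b c => by rw [mul_zero, zero_mul, map_zero])
    (fun ha ha' b c => by rw [mul_add, add_mul, map_add, ha, ha', add_zero])
    (fun ha b c => by rw [mul_neg, neg_mul, map_neg, ha, neg_zero])
    (fun ha b c => by rw [← mul_assoc, ha])
    (fun ha b c => by rw [← mul_assoc, mul_assoc _ _ c, ha])

variable {τ : R →ₗ[k] M} {a b w : R}

theorem mem_kerCore : a ∈ kerCore τ ↔ ∀ b c, τ (b * a * c) = 0 :=
  TwoSidedIdeal.mem_mk' ..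

theorem le_kerCore_iff {I : TwoSidedIdeal R} : I ≤ kerCore τ ↔ ∀ a ∈ I, τ a = 0 := by
  refine ⟨fun h a ha => ?_, fun h a ha => mem_kerCore.mpr fun b c => ?_⟩
  · simpa only [one_mul, mul_one] using mem_kerCore.mp (h ha) 1 1
  · exact h _ (I.mul_mem_right _ _ (I.mul_mem_left _ _ ha))

theorem exists_linearMap_quotient_iff_le_kerCore (I : TwoSidedIdeal R) :
    (∃ σ : I.ringCon.Quotient →ₗ[k] M, ∀ a, σ (I.ringCon.mk' a) = τ a) ↔ I ≤ kerCore τ := by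
  rw [le_kerCore_iff]
  constructor
  · rintro ⟨σ, hσ⟩ a ha
    have hmk : I.ringCon.mk' a = 0 := (RingCon.eq _).mpr ha
    rw [← hσ, hmk, map_zero]
  · intro h
    have hrel {a b : R} (hab : I.ringCon a b) : τ a = τ b :=
      sub_eq_zero.mp ((map_sub τ a b).symm.trans (h _ ((I.rel_iff a b).mp hab)))
    exact ⟨{ toFun := fun q => Quotient.liftOn' q τ fun _ _ => hrel
             map_add' := by rintro ⟨a⟩ ⟨b⟩; exact map_add τ a b
             map_smul' := by rintro c ⟨a⟩; exact map_smul τ c a }, fun _ => rfl⟩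

theorem mem_kerCore_iff_of_trace (hτ : ∀ a b, τ (a * b) = τ (b * a)) :
    a ∈ kerCore τ ↔ ∀ b, τ (b * a) = 0 := by
  refine ⟨fun h b => ?_, fun h => mem_kerCore.mpr fun b c => ?_⟩
  · simpa only [mul_one] using mem_kerCore.mp h b 1
  · rw [hτ, ← mul_assoc, h]

theorem trace_eq_of_semiconjBy (hτ : ∀ a b, τ (a * b) = τ (b * a)) (hw : IsUnit w)
    (h : SemiconjBy w a b) : τ a = τ b := by
  obtain ⟨w, rfl⟩ := hw
  rw [← (Units.mul_inv_eq_iff_eq_mul w).mpr h.eq, hτ, Units.inv_mul_cancel_left]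

end KerCore

theorem mem_of_semiconjBy {R : Type*} [Ring R] {I : TwoSidedIdeal R} {a b w : R} (hw : IsUnit w)
    (h : SemiconjBy w a b) (ha : a ∈ I) : b ∈ I := by
  obtain ⟨w, rfl⟩ := hw
  rw [← (Units.mul_inv_eq_iff_eq_mul w).mpr h.eq]
  exact I.mul_mem_right _ _ (I.mul_mem_left _ _ ha)

theorem semiconjBy_sum_right {R ι : Type*} [NonUnitalNonAssocSemiring R] {w : R} (s : Finset ι)
    {f f' : ι → R} (h : ∀ i ∈ s, SemiconjBy w (f i) (f' i)) :
    SemiconjBy w (∑ i ∈ s, f i) (∑ i ∈ s, f' i) := by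
  rw [SemiconjBy, Finset.mul_sum, Finset.sum_mul]
  exact Finset.sum_congr rfl h

section Fourier

open ZMod

variable {d : ℕ} [NeZero d] {E : Type*} [AddCommGroup E] [Module ℂ E]

/-- The `m`-th Fourier coefficient of `f : ZMod d → E`. It is `ZMod.dft` rescaled so that no factor
is left in the inversion formula `f k = ∑ m, χ(k m) • dftCoeff f m`. -/
noncomputable def dftCoeff (f : ZMod d → E) (m : ZMod d) : E :=
  (d : ℂ)⁻¹ • dft f m

theorem sum_stdAddChar_smul (f : ZMod d → E) (m : ZMod d) :
    ∑ k : ZMod d, stdAddChar (-(k * m)) • f k = (d : ℂ) • dftCoeff f m := by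
  rw [dftCoeff, dft_apply, smul_inv_smul₀ (NeZero.ne (d : ℂ))]

theorem dftCoeff_eq_iff {f c : ZMod d → E} :
    (∀ m, dftCoeff f m = c m) ↔ ∀ k, f k = ∑ m, stdAddChar (k * m) • c m := by
  have hd : (d : ℂ) ≠ 0 := NeZero.ne _
  have hdft : (∀ m, dftCoeff f m = c m) ↔ dft f = (d : ℂ) • c := by
    simp only [dftCoeff, funext_iff, Pi.smul_apply, inv_smul_eq_iff₀ hd]
  rw [hdft, ← LinearEquiv.eq_symm_apply, _root_.map_smul, funext_iff]
  refine forall_congr' fun k => ?_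
  rw [Pi.smul_apply, invDFT_apply, smul_inv_smul₀ hd]
  simp only [mul_comm k]

theorem eq_sum_dftCoeff (f : ZMod d → E) (k : ZMod d) :
    f k = ∑ m, stdAddChar (k * m) • dftCoeff f m :=
  dftCoeff_eq_iff.mp (fun _ => rfl) k

theorem map_dftCoeff {F : Type*} [AddCommGroup F] [Module ℂ F] (L : E →ₗ[ℂ] F) (f : ZMod d → E)
    (m : ZMod d) : L (dftCoeff f m) = dftCoeff (fun k => L (f k)) m := by
  simp only [dftCoeff, dft_apply, _root_.map_smul, map_sum]

theorem support_dftCoeff (f : ZMod d → E) :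
    Function.support (dftCoeff f) = Function.support (dft f) := by
  ext m
  simp only [Function.mem_support, dftCoeff, ne_eq, smul_eq_zero, inv_eq_zero,
    NeZero.ne (d : ℂ), false_or]

end Fourier

section FourierSupport

theorem forall_mul_add_mul_add_eq_zero_iff {ι R : Type*} [Finite ι] [DecidableEq ι] [CommRing R]
    [NoZeroDivisors R] (c : ι → R) (a b : R) :
    (∀ m, c m * (c m + a) * (c m + b) = 0) ↔
      ∃ S₁ S₂ : Finset ι, Disjoint S₁ S₂ ∧ ((S₁ ∪ S₂ : Finset ι) : Set ι) = Function.support c ∧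
        ∀ m, c m = (if m ∈ S₁ then -a else 0) + if m ∈ S₂ then -b else 0 := by
  classical
  cases nonempty_fintype ι
  constructor
  · intro h
    refine ⟨Finset.univ.filter fun m => c m ≠ 0 ∧ c m = -a,
      Finset.univ.filter fun m => c m ≠ 0 ∧ c m ≠ -a, ?_, ?_, fun m => ?_⟩
    · exact Finset.disjoint_filter.mpr fun m _ h₁ h₂ => h₂.2 h₁.2
    · rw [← Finset.filter_or]
      ext m
      simp only [← and_or_left, em, and_true, Finset.coe_filter, Finset.mem_univ, true_and,
        Function.mem_support, Set.mem_ofPred_eq]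
    · have hm : (c m = 0 ∨ c m = -a) ∨ c m = -b := by
        simpa only [mul_eq_zero, add_eq_zero_iff_eq_neg] using h m
      simp only [Finset.mem_filter, Finset.mem_univ, true_and]
      grind
  · rintro ⟨S₁, S₂, hdisj, -, h⟩ m
    rw [h m]
    by_cases h₁ : m ∈ S₁
    · simp [h₁, Finset.disjoint_left.mp hdisj h₁]
    · by_cases h₂ : m ∈ S₂ <;> simp [h₁, h₂]

variable {d : ℕ} [NeZero d] {x : ZMod d → ℂ} {S₁ S₂ : Finset (ZMod d)} {v z : ℂ}

theorem dftCoeff_eq_ite_add_ite_iff :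
    (∀ m, dftCoeff x m = (if m ∈ S₁ then -z else 0) + if m ∈ S₂ then -(v * z) else 0) ↔
      ∀ k, x k = -z * (∑ m ∈ S₁, ZMod.stdAddChar (k * m) +
        v * ∑ m ∈ S₂, ZMod.stdAddChar (k * m)) := by
  rw [dftCoeff_eq_iff]
  refine forall_congr' fun k => ?_
  simp only [smul_eq_mul, mul_add, mul_ite, mul_zero, Finset.sum_add_distrib, Finset.sum_ite_mem,
    Finset.univ_inter, ← Finset.sum_mul]
  ring_nf

theorem neg_mul_card_add_card_eq_one (hx : x 0 = 1)
    (h : ∀ k, x k = -z * (∑ m ∈ S₁, ZMod.stdAddChar (k * m) +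
      v * ∑ m ∈ S₂, ZMod.stdAddChar (k * m))) :
    -z * ((S₁.card : ℂ) + v * S₂.card) = 1 := by
  simpa only [hx, zero_mul, AddChar.map_zero_eq_one, Finset.sum_const, nsmul_eq_mul, mul_one]
    using (h 0).symm

theorem neg_mul_eq_one_iff {K : Type*} [Field K] {a b : K} : -a * b = 1 ↔ b ≠ 0 ∧ a = -1 / b := by
  constructor
  · intro h
    have hb : b ≠ 0 := right_ne_zero_of_mul_eq_one h
    exact ⟨hb, by rw [eq_div_iff hb, ← h, neg_mul, neg_neg]⟩
  · rintro ⟨hb, rfl⟩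
    rw [neg_mul, div_mul_cancel₀ _ hb, neg_neg]

end FourierSupport

section EigenProj

open ZMod

variable {d : ℕ} [NeZero d] {R : Type*} [Ring R] [Algebra ℂ R] {t t' w : R}

/-- The `m`-th Fourier coefficient of the sequence of powers of `t`. If `t ^ d = 1`, it is the
idempotent onto the eigenspace of `t` for the eigenvalue `χ(m)`. -/
noncomputable def eigenProj (t : R) (m : ZMod d) : R :=
  dftCoeff (fun s : ZMod d => t ^ s.val) m

theorem semiconjBy_eigenProj (h : SemiconjBy w t t') (m : ZMod d) :
    SemiconjBy w (eigenProj t m) (eigenProj t' m) :=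
  (semiconjBy_sum_right _ fun _ _ => (h.pow_right _).smul_right _).smul_right _

theorem commute_eigenProj_eigenProj (h : Commute t t') (m m' : ZMod d) :
    Commute (eigenProj t m) (eigenProj t' m') :=
  semiconjBy_eigenProj (semiconjBy_eigenProj h.symm m).symm m'

theorem map_eigenProj {S : Type*} [Ring S] [Algebra ℂ S] (f : R →ₐ[ℂ] S) (t : R) (m : ZMod d) :
    f (eigenProj t m) = eigenProj (f t) m := by
  simpa only [eigenProj, AlgHom.toLinearMap_apply, map_pow] using
    map_dftCoeff f.toLinearMap (fun s => t ^ s.val) m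

theorem mul_eigenProj (ht : t ^ d = 1) (m : ZMod d) :
    t * eigenProj t m = stdAddChar m • eigenProj t m := by
  have hpow (s : ZMod d) : t ^ (s + 1).val = t * t ^ s.val := by
    rw [← pow_succ', pow_eq_pow_mod (s.val + 1) ht, val_add, val_one_eq_one_mod, Nat.add_mod_mod]
  refine (map_dftCoeff (LinearMap.mulLeft ℂ t) _ m).trans
    (dftCoeff_eq_iff (c := fun m => stdAddChar m • eigenProj t m) |>.mpr (fun s => ?_) m)
  rw [LinearMap.mulLeft_apply, ← hpow, eq_sum_dftCoeff (fun s : ZMod d => t ^ s.val)]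
  exact Finset.sum_congr rfl fun m _ => by
    rw [smul_smul, ← AddChar.map_add_eq_mul, add_one_mul, eigenProj]

theorem eigenProj_mul_of_mul_eq_smul {y : R} {m : ZMod d} (h : t * y = stdAddChar m • y)
    (m' : ZMod d) : eigenProj t m' * y = if m' = m then y else 0 := by
  have hpow (s : ℕ) : t ^ s * y = stdAddChar (s * m : ZMod d) • y := by
    induction s with
    | zero => rw [pow_zero, one_mul, Nat.cast_zero, zero_mul, AddChar.map_zero_eq_one, one_smul]
    | succ s ih =>
      rw [pow_succ', mul_assoc, ih, mul_smul_comm, h, smul_smul, ← AddChar.map_add_eq_mul,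
        Nat.cast_succ, add_one_mul]
  refine (map_dftCoeff (LinearMap.mulRight ℂ y) _ m').trans
    (dftCoeff_eq_iff (c := fun m' => if m' = m then y else 0) |>.mpr (fun s => ?_) m')
  simp only [LinearMap.mulRight_apply, hpow, natCast_zmod_val, smul_ite, smul_zero,
    Finset.sum_ite_eq', Finset.mem_univ, if_true]

theorem eigenProj_mul_self (ht : t ^ d = 1) (m : ZMod d) :
    eigenProj t m * eigenProj t m = eigenProj t m := by
  rw [eigenProj_mul_of_mul_eq_smul (mul_eigenProj ht m), if_pos rfl]

-- Expanding only `t₁ ^ a` with `a = -(b + c)` decouples the sums over `b` and `c`.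
theorem sum_pow_mul_pow_mul_pow (t₁ t₂ t₃ : R) :
    ∑ a : ZMod d, ∑ b : ZMod d, ∑ c : ZMod d,
        (if a + b + c = 0 then t₁ ^ a.val * t₂ ^ b.val * t₃ ^ c.val else 0) =
      (d : ℂ) ^ 2 • ∑ m : ZMod d, eigenProj t₁ m * eigenProj t₂ m * eigenProj t₃ m := by
  have hsolve (b c : ZMod d) :
      ∑ a : ZMod d, (if a + b + c = 0 then t₁ ^ a.val * t₂ ^ b.val * t₃ ^ c.val else 0) =
        t₁ ^ (-(b + c)).val * t₂ ^ b.val * t₃ ^ c.val := by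
    simp only [add_assoc, add_eq_zero_iff_eq_neg, Finset.sum_ite_eq', Finset.mem_univ, if_true]
  have hsplit (b c : ZMod d) : t₁ ^ (-(b + c)).val * t₂ ^ b.val * t₃ ^ c.val =
      ∑ m : ZMod d, eigenProj t₁ m * (stdAddChar (-(b * m)) • t₂ ^ b.val) *
        (stdAddChar (-(c * m)) • t₃ ^ c.val) := by
    rw [eq_sum_dftCoeff (fun s : ZMod d => t₁ ^ s.val)]
    simp only [eigenProj, Finset.sum_mul, smul_mul_assoc, mul_smul_comm, smul_smul,
      ← AddChar.map_add_eq_mul]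
    exact Finset.sum_congr rfl fun m _ => by congr 2; ring
  calc _ = ∑ b : ZMod d, ∑ c : ZMod d, ∑ a : ZMod d,
        (if a + b + c = 0 then t₁ ^ a.val * t₂ ^ b.val * t₃ ^ c.val else 0) := by
        rw [Finset.sum_comm]
        exact Finset.sum_congr rfl fun b _ => Finset.sum_comm
    _ = ∑ m : ZMod d, eigenProj t₁ m * (∑ b : ZMod d, stdAddChar (-(b * m)) • t₂ ^ b.val) *
        ∑ c : ZMod d, stdAddChar (-(c * m)) • t₃ ^ c.val := by
        simp only [hsolve, hsplit, Finset.mul_sum, Finset.sum_mul]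
        rw [Finset.sum_comm, Finset.sum_comm_cycle]
    _ = _ := by
        simp only [eigenProj, sum_stdAddChar_smul fun s : ZMod d => _ ^ s.val, mul_smul_comm,
          smul_mul_assoc, smul_smul, Finset.smul_sum, pow_two]

end EigenProj

section Quadratic

variable {R : Type*} [Ring R] [Algebra ℂ R] {u : ℂ} {e x y G : R}

theorem mul_mul_self_of_quadratic (hG : G * G = 1 + (u - 1) • e + (u - 1) • (e * G))
    (hx : x * e = x) : x * G * G = u • x + (u - 1) • (x * G) := by
  rw [mul_assoc, hG, mul_add, mul_add, mul_one, mul_smul_comm, mul_smul_comm, ← mul_assoc, hx]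
  module

theorem mul_one_add_mul_one_add (h : y * G * G = u • y + (u - 1) • (y * G)) :
    y * (1 + G) * (1 + G) = (u + 1) • (y * (1 + G)) := by
  simp only [mul_add, add_mul, mul_one, h]
  module

theorem isUnit_of_quadratic (hu : u ≠ 0) (hG : G * G = 1 + (u - 1) • e + (u - 1) • (e * G))
    (he : e * e = e) : IsUnit G := by
  have heG : e * G * G = u • e + (u - 1) • (e * G) := mul_mul_self_of_quadratic hG he
  -- `G` is a root of the cubic `(X ^ 2 - 1) * (X - u)`, whose constant term is `u`.
  have hcubic : G * (-u⁻¹ • (G * G - u • G - 1)) = 1 := by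
    have h3 : G * (G * G) = u • (G * G) + G - u • 1 := by
      rw [← mul_assoc, hG]
      simp only [add_mul, smul_mul_assoc, heG]
      simp only [one_mul]
      match_scalars <;> ring
    rw [mul_smul_comm, mul_sub, mul_sub, mul_smul_comm, mul_one, h3]
    match_scalars <;> field_simp <;> ring
  have hcomm : Commute G (-u⁻¹ • (G * G - u • G - 1)) :=
    ((((Commute.refl G).mul_right (.refl G)).sub_right ((Commute.refl G).smul_right u)).sub_right
      (.one_right G)).smul_right _
  exact (hcomm.isUnit_mul_iff.mp (hcubic.symm ▸ isUnit_one)).1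

theorem mul_mul_one_add (hxG : Commute x G) (h : x * G * G = u • x + (u - 1) • (x * G)) :
    G * (x * (1 + G)) = u • (x * (1 + G)) := by
  rw [← mul_assoc, ← hxG.eq, mul_add, mul_add, mul_one, mul_one, h]
  module

end Quadratic

namespace YokonumaHecke

variable {d n : ℕ} {u : ℂ}

section Relations

theorem g_mul_g_comm (i j : ℕ) (hi : i + 1 < n) (hj : j + 1 < n) (hij : i + 1 < j ∨ j + 1 < i) :
    Commute (g i hi : YokonumaHecke d n u) (g j hj) := by
  simpa only [g, commute_iff_eq, map_mul] using
    RingQuot.mkAlgHom_rel ℂ (YHRel.g_comm (d := d) (u := u) i j hi hj hij)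

theorem g_braid (i : ℕ) (hi : i + 1 < n) (hi' : i + 1 + 1 < n) :
    (g (i + 1) hi' * g i hi * g (i + 1) hi' : YokonumaHecke d n u) =
      g i hi * g (i + 1) hi' * g i hi := by
  simpa only [g, map_mul] using RingQuot.mkAlgHom_rel ℂ (YHRel.braid (d := d) (u := u) i hi hi')

theorem commute_t_t (i j : ℕ) (hi : i < n) (hj : j < n) :
    Commute (t i hi : YokonumaHecke d n u) (t j hj) := by
  simpa only [t, commute_iff_eq, map_mul] using
    RingQuot.mkAlgHom_rel ℂ (YHRel.t_comm (d := d) (u := u) i j hi hj)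

theorem t_pow_d (i : ℕ) (hi : i < n) : (t i hi : YokonumaHecke d n u) ^ d = 1 := by
  simpa only [t, map_pow, map_one] using
    RingQuot.mkAlgHom_rel ℂ (YHRel.t_pow (d := d) (u := u) i hi)

theorem semiconjBy_g_t_left (i : ℕ) (hi : i + 1 < n) :
    SemiconjBy (g i hi : YokonumaHecke d n u) (t i (by omega)) (t (i + 1) hi) := by
  simpa only [g, t, SemiconjBy, map_mul] using
    RingQuot.mkAlgHom_rel ℂ (YHRel.g_t_left (d := d) (u := u) i hi (by omega))

theorem semiconjBy_g_t_right (i : ℕ) (hi : i + 1 < n) :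
    SemiconjBy (g i hi : YokonumaHecke d n u) (t (i + 1) hi) (t i (by omega)) := by
  simpa only [g, t, SemiconjBy, map_mul] using
    RingQuot.mkAlgHom_rel ℂ (YHRel.g_t_right (d := d) (u := u) i hi (by omega))

theorem commute_g_t (i j : ℕ) (hi : i + 1 < n) (hj : j < n) (h : j ≠ i) (h' : j ≠ i + 1) :
    Commute (g i hi : YokonumaHecke d n u) (t j hj) := by
  simpa only [g, t, commute_iff_eq, map_mul] using
    RingQuot.mkAlgHom_rel ℂ (YHRel.g_t_other (d := d) (u := u) i j hi hj h h')

/-- The element `e_i = (1/d) ∑_s t_i^s t_{i+1}^{d-s}` of the quadratic relation. -/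
noncomputable def e (i : ℕ) (hi : i + 1 < n) : YokonumaHecke d n u :=
  (1 / (d : ℂ)) • ∑ s ∈ Finset.range d, t i (by omega) ^ s * t (i + 1) hi ^ (d - s)

theorem g_mul_g (i : ℕ) (hi : i + 1 < n) :
    (g i hi * g i hi : YokonumaHecke d n u) =
      1 + (u - 1) • e i hi + (u - 1) • (e i hi * g i hi) := by
  simpa only [g, t, e, YHFree.e, map_add, map_smul, map_sum, map_mul, map_pow, map_one, pow_two]
    using RingQuot.mkAlgHom_rel ℂ (YHRel.quadratic (d := d) (u := u) i hi)

theorem incl_mkAlgHom (a : FreeAlgebra ℂ (YHGen n)) :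
    incl (RingQuot.mkAlgHom ℂ (YHRel d n u) a) = FreeAlgebra.lift ℂ inclGen a :=
  RingQuot.liftAlgHom_mkAlgHom_apply ..

theorem incl_g (i : ℕ) (hi : i + 1 < n) :
    incl (g i hi : YokonumaHecke d n u) = g i (by omega) := by
  rw [g, incl_mkAlgHom, lift_inclGen_g, g]

theorem incl_t (j : ℕ) (hj : j < n) :
    incl (t j hj : YokonumaHecke d n u) = t j (by omega) := by
  rw [t, incl_mkAlgHom, lift_inclGen_t, t]

end Relations

section Invertibility

theorem mul_e_of_mul_t_eq [NeZero d] {x : YokonumaHecke d n u} (i : ℕ) (hi : i + 1 < n)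
    (hx : x * t i (by omega) = x * t (i + 1) hi) : x * e i hi = x := by
  have hpow (s : ℕ) : x * t i (by omega) ^ s = x * t (i + 1) hi ^ s := by
    induction s with
    | zero => rw [pow_zero, pow_zero]
    | succ s ih =>
      rw [pow_succ, ← mul_assoc, ih, mul_assoc, ((commute_t_t (i + 1) i _ _).pow_left s).eq,
        ← mul_assoc, hx, mul_assoc, ← pow_succ']
  have hterm : ∀ s ∈ Finset.range d, x * (t i (by omega) ^ s * t (i + 1) hi ^ (d - s)) = x := by
    intro s hs
    rw [← mul_assoc, hpow, mul_assoc, ← pow_add, Nat.add_sub_cancel' (Finset.mem_range.mp hs).le,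
      t_pow_d, mul_one]
  rw [e, mul_smul_comm, Finset.mul_sum, Finset.sum_congr rfl hterm, Finset.sum_const,
    Finset.card_range, ← Nat.cast_smul_eq_nsmul ℂ, smul_smul,
    one_div_mul_cancel (NeZero.ne (d : ℂ)), one_smul]

theorem e_mul_t_left (i : ℕ) (hi : i + 1 < n) :
    (e i hi * t i (by omega) : YokonumaHecke d n u) = e i hi * t (i + 1) hi := by
  let f (s : ℕ) : YokonumaHecke d n u := t i (by omega) ^ s * t (i + 1) hi ^ (d + 1 - s)
  have hterm : ∀ s ∈ Finset.range d, t i (by omega) ^ s * t (i + 1) hi ^ (d - s) * t i (by omega) -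
      t i (by omega) ^ s * t (i + 1) hi ^ (d - s) * t (i + 1) hi = f (s + 1) - f s := by
    intro s hs
    have hsd : d + 1 - s = d - s + 1 := Nat.sub_add_comm (Finset.mem_range.mp hs).le
    simp only [f]
    rw [mul_assoc, ((commute_t_t (i + 1) i _ _).pow_left _).eq, ← mul_assoc, ← pow_succ, mul_assoc,
      ← pow_succ, Nat.add_sub_add_right, hsd]
  have hends : f d = f 0 := by
    simp only [f, t_pow_d, pow_succ, Nat.add_sub_cancel_left, Nat.sub_zero, pow_zero,
      one_mul]
  rw [e, smul_mul_assoc, smul_mul_assoc, Finset.sum_mul, Finset.sum_mul]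
  congr 1
  rw [← sub_eq_zero, ← Finset.sum_sub_distrib, Finset.sum_congr rfl hterm, Finset.sum_range_sub,
    hends, sub_self]

theorem e_mul_e [NeZero d] (i : ℕ) (hi : i + 1 < n) :
    (e i hi * e i hi : YokonumaHecke d n u) = e i hi :=
  mul_e_of_mul_t_eq i hi (e_mul_t_left i hi)

theorem isUnit_g [NeZero d] (hu : u ≠ 0) (i : ℕ) (hi : i + 1 < n) :
    IsUnit (g i hi : YokonumaHecke d n u) :=
  isUnit_of_quadratic hu (g_mul_g i hi) (e_mul_e i hi)

theorem mul_g_mul_g [NeZero d] {x : YokonumaHecke d n u} (i : ℕ) (hi : i + 1 < n)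
    (hx : x * t i (by omega) = x * t (i + 1) hi) :
    x * g i hi * g i hi = u • x + (u - 1) • (x * g i hi) :=
  mul_mul_self_of_quadratic (g_mul_g i hi) (mul_e_of_mul_t_eq i hi hx)

end Invertibility

section Generation

theorem mem_subalgebra_of_generators {A : Subalgebra ℂ (YokonumaHecke d n u)}
    (hg : ∀ i hi, g i hi ∈ A) (ht : ∀ j hj, t j hj ∈ A) (y : YokonumaHecke d n u) : y ∈ A := by
  obtain ⟨y, rfl⟩ := RingQuot.mkAlgHom_surjective ℂ (YHRel d n u) y
  induction y using FreeAlgebra.induction with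
  | grade0 c => rw [AlgHom.commutes]; exact A.algebraMap_mem c
  | grade1 v =>
    cases v with
    | g i hi => exact hg i hi
    | t j hj => exact ht j hj
  | mul a b ha hb => rw [map_mul]; exact A.mul_mem ha hb
  | add a b ha hb => rw [map_add]; exact A.add_mem ha hb

theorem mul_mem_of_generators {V : Submodule ℂ (YokonumaHecke d n u)}
    (hg : ∀ i hi, ∀ v ∈ V, g i hi * v ∈ V) (ht : ∀ j hj, ∀ v ∈ V, t j hj * v ∈ V)
    (y : YokonumaHecke d n u) : ∀ v ∈ V, y * v ∈ V :=
  mem_subalgebra_of_generators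
    (A := { carrier := {y | ∀ v ∈ V, y * v ∈ V}
            mul_mem' := fun ha hb v hv => by rw [mul_assoc]; exact ha _ (hb _ hv)
            add_mem' := fun ha hb v hv => by rw [add_mul]; exact V.add_mem (ha _ hv) (hb _ hv)
            algebraMap_mem' := fun c v hv => by
              rw [← Algebra.smul_def]; exact V.smul_mem c hv }) hg ht y

theorem commute_algHom_of_generators {R : Type*} [Ring R] [Algebra ℂ R]
    (f : YokonumaHecke d n u →ₐ[ℂ] R) {b : R} (hg : ∀ i hi, Commute b (f (g i hi)))
    (ht : ∀ j hj, Commute b (f (t j hj))) (a : YokonumaHecke d n u) : Commute b (f a) := by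
  have hmem : a ∈ (Subalgebra.centralizer ℂ {b}).comap f := by
    refine mem_subalgebra_of_generators (fun i hi => ?_) (fun j hj => ?_) a
    · exact (Subalgebra.mem_centralizer_iff ℂ).mpr fun _ hb => hb ▸ (hg i hi).eq
    · exact (Subalgebra.mem_centralizer_iff ℂ).mpr fun _ hb => hb ▸ (ht j hj).eq
  exact (Subalgebra.mem_centralizer_iff ℂ).mp hmem b rfl

theorem commute_t_last_incl (a : YokonumaHecke d n u) :
    Commute (t n (by omega)) (incl a) :=
  commute_algHom_of_generators incl
    (fun i hi => by rw [incl_g]; exact (commute_g_t i n _ _ (by omega) (by omega)).symm)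
    (fun j hj => by rw [incl_t]; exact commute_t_t n j _ _) a

theorem commute_g_last_incl_incl (a : YokonumaHecke d n u) :
    Commute (g n (by omega)) (incl (incl a)) :=
  commute_algHom_of_generators (incl.comp incl)
    (fun i hi => by
      rw [AlgHom.comp_apply, incl_g, incl_g]
      exact g_mul_g_comm n i _ _ (by omega))
    (fun j hj => by
      rw [AlgHom.comp_apply, incl_t, incl_t]
      exact commute_g_t n j _ _ (by omega) (by omega)) a

end Generation

section InductiveSpan

/-- The elements of `Y_{d,n+1}(u)` that involve the last strand in the inductive normal form: the
powers of `t_n`, and `g_{n-1}` when `n ≥ 1`. -/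
def lastGens (d n : ℕ) (u : ℂ) : Set (YokonumaHecke d (n + 1) u) :=
  {w | (∃ s : ℕ, w = t n (by omega) ^ s) ∨ ∃ (i : ℕ) (hi : i + 1 < n + 1), i + 1 = n ∧ w = g i hi}

/-- The `Y_{d,n}(u)`-sub-bimodule of `Y_{d,n+1}(u)` generated by `lastGens`. -/
noncomputable def inductiveSpan (d n : ℕ) (u : ℂ) : Submodule ℂ (YokonumaHecke d (n + 1) u) :=
  Submodule.span ℂ {y | ∃ w ∈ lastGens d n u, ∃ a b, y = incl a * w * incl b}

variable {w y : YokonumaHecke d (n + 1) u}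

theorem t_pow_mem_lastGens (s : ℕ) : t n (by omega) ^ s ∈ lastGens d n u :=
  Or.inl ⟨s, rfl⟩

theorem g_mem_lastGens : g n (by omega) ∈ lastGens d (n + 1) u :=
  Or.inr ⟨n, by omega, rfl, rfl⟩

theorem map_mem_of_mem_inductiveSpan {M : Type*} [AddCommGroup M] [Module ℂ M]
    (f : YokonumaHecke d (n + 1) u →ₗ[ℂ] M) {V : Submodule ℂ M}
    (h : ∀ w ∈ lastGens d n u, ∀ a b, f (incl a * w * incl b) ∈ V)
    (hy : y ∈ inductiveSpan d n u) : f y ∈ V := by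
  have hle : inductiveSpan d n u ≤ V.comap f := by
    refine Submodule.span_le.mpr ?_
    rintro _ ⟨w, hw, a, b, rfl⟩
    exact h w hw a b
  exact hle hy

theorem mem_inductiveSpan_of_mem_lastGens (hw : w ∈ lastGens d n u) : w ∈ inductiveSpan d n u :=
  Submodule.subset_span ⟨w, hw, 1, 1, by rw [map_one, one_mul, mul_one]⟩

theorem one_mem_inductiveSpan : (1 : YokonumaHecke d (n + 1) u) ∈ inductiveSpan d n u := by
  simpa only [pow_zero] using mem_inductiveSpan_of_mem_lastGens (t_pow_mem_lastGens 0)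

theorem incl_mul_mul_incl_mem (hy : y ∈ inductiveSpan d n u) (a b : YokonumaHecke d n u) :
    incl a * y * incl b ∈ inductiveSpan d n u :=
  map_mem_of_mem_inductiveSpan (LinearMap.mulLeftRight ℂ (incl a, incl b))
    (fun w hw a' b' => Submodule.subset_span ⟨w, hw, a * a', b' * b, by
      simp only [LinearMap.mulLeftRight_apply, map_mul, mul_assoc]⟩) hy

theorem incl_mul_mem (hy : y ∈ inductiveSpan d n u) (a : YokonumaHecke d n u) :
    incl a * y ∈ inductiveSpan d n u := by
  simpa only [map_one, mul_one] using incl_mul_mul_incl_mem hy a 1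

theorem mul_incl_mem (hy : y ∈ inductiveSpan d n u) (b : YokonumaHecke d n u) :
    y * incl b ∈ inductiveSpan d n u := by
  simpa only [map_one, one_mul] using incl_mul_mul_incl_mem hy 1 b

theorem mul_mem_inductiveSpan {h : YokonumaHecke d (n + 1) u}
    (hh : ∀ w ∈ lastGens d n u, ∀ a, h * (incl a * w) ∈ inductiveSpan d n u)
    (hy : y ∈ inductiveSpan d n u) : h * y ∈ inductiveSpan d n u :=
  map_mem_of_mem_inductiveSpan (LinearMap.mulLeft ℂ h)
    (fun w hw a b => by
      rw [LinearMap.mulLeft_apply, ← mul_assoc]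
      exact mul_incl_mem (hh w hw a) b) hy

theorem t_mul_mem (hy : y ∈ inductiveSpan d n u) : t n (by omega) * y ∈ inductiveSpan d n u := by
  refine mul_mem_inductiveSpan (fun w hw a => ?_) hy
  rw [← mul_assoc, (commute_t_last_incl a).eq, mul_assoc]
  refine incl_mul_mem ?_ a
  obtain ⟨s, rfl⟩ | ⟨i, hi, rfl, rfl⟩ := hw
  · rw [← pow_succ']
    exact mem_inductiveSpan_of_mem_lastGens (t_pow_mem_lastGens _)
  · rw [← (semiconjBy_g_t_left i hi).eq, ← incl_t i (by omega)]
    exact mul_incl_mem (mem_inductiveSpan_of_mem_lastGens g_mem_lastGens) _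

theorem t_pow_mul_mem (s : ℕ) (hy : y ∈ inductiveSpan d n u) :
    t n (by omega) ^ s * y ∈ inductiveSpan d n u := by
  induction s with
  | zero => rwa [pow_zero, one_mul]
  | succ s ih => rw [pow_succ', mul_assoc]; exact t_mul_mem ih

theorem e_mul_mem {y : YokonumaHecke d (n + 2) u} (hy : y ∈ inductiveSpan d (n + 1) u) :
    e n (by omega) * y ∈ inductiveSpan d (n + 1) u := by
  rw [e, smul_mul_assoc, Finset.sum_mul]
  refine Submodule.smul_mem _ _ (Submodule.sum_mem _ fun s _ => ?_)
  rw [mul_assoc, ← incl_t n (by omega), ← map_pow]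
  exact incl_mul_mem (t_pow_mul_mem _ hy) _

theorem g_mul_g_mem :
    (g n (by omega) * g n (by omega) : YokonumaHecke d (n + 2) u) ∈ inductiveSpan d (n + 1) u := by
  rw [g_mul_g, ← mul_one (e n _), mul_assoc, one_mul]
  exact add_mem (add_mem one_mem_inductiveSpan
    (Submodule.smul_mem _ _ (e_mul_mem one_mem_inductiveSpan)))
    (Submodule.smul_mem _ _ (e_mul_mem (mem_inductiveSpan_of_mem_lastGens g_mem_lastGens)))

theorem g_mul_incl_mul_g_mem (h : inductiveSpan d n u = ⊤) (a : YokonumaHecke d (n + 1) u) :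
    g n (by omega) * incl a * g n (by omega) ∈ inductiveSpan d (n + 1) u := by
  have hlast : ∀ w ∈ lastGens d n u,
      g n (by omega) * incl w * g n (by omega) ∈ inductiveSpan d (n + 1) u := by
    rintro _ (⟨s, rfl⟩ | ⟨i, hi, rfl, rfl⟩)
    · rw [map_pow, incl_t, ((semiconjBy_g_t_left n _).pow_right s).eq, mul_assoc]
      exact t_pow_mul_mem s g_mul_g_mem
    · rw [incl_g, g_braid, ← incl_g i (by omega)]
      exact incl_mul_mul_incl_mem (mem_inductiveSpan_of_mem_lastGens g_mem_lastGens) _ _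
  refine map_mem_of_mem_inductiveSpan
    (LinearMap.mulLeftRight ℂ (g n (by omega), g n (by omega)) ∘ₗ incl.toLinearMap)
    (fun w hw b c => ?_) (h ▸ Submodule.mem_top : a ∈ inductiveSpan d n u)
  have hpull : g n (by omega) * incl (incl b * w * incl c) * g n (by omega) =
      incl (incl b) * (g n (by omega) * incl w * g n (by omega)) * incl (incl c) := by
    rw [map_mul, map_mul, ← mul_assoc, ← mul_assoc, (commute_g_last_incl_incl b).eq,
      mul_assoc _ _ (g n _), ← (commute_g_last_incl_incl c).eq]
    simp only [mul_assoc]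
  rw [LinearMap.comp_apply, LinearMap.mulLeftRight_apply, AlgHom.toLinearMap_apply, hpull]
  exact incl_mul_mul_incl_mem (hlast w hw) _ _

theorem g_mul_mem (h : inductiveSpan d n u = ⊤) {y : YokonumaHecke d (n + 2) u}
    (hy : y ∈ inductiveSpan d (n + 1) u) : g n (by omega) * y ∈ inductiveSpan d (n + 1) u := by
  refine mul_mem_inductiveSpan (fun w hw a => ?_) hy
  obtain ⟨s, rfl⟩ | ⟨i, hi, hin, rfl⟩ := hw
  · rw [← ((commute_t_last_incl a).pow_left s).eq, ← mul_assoc,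
      ((semiconjBy_g_t_right n _).pow_right s).eq, ← incl_t n (by omega), ← map_pow]
    exact incl_mul_mul_incl_mem (mem_inductiveSpan_of_mem_lastGens g_mem_lastGens) _ a
  · obtain rfl : i = n := by omega
    rw [← mul_assoc]
    exact g_mul_incl_mul_g_mem h a

theorem inductiveSpan_eq_top : inductiveSpan d n u = ⊤ := by
  suffices hideal : ∀ y, ∀ v ∈ inductiveSpan d n u, y * v ∈ inductiveSpan d n u by
    exact eq_top_iff.mpr fun y _ => mul_one y ▸ hideal y 1 one_mem_inductiveSpan
  induction n with
  | zero =>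
    refine mul_mem_of_generators (fun i hi => by omega) (fun j hj v hv => ?_)
    obtain rfl : j = 0 := by omega
    exact t_mul_mem hv
  | succ n ih =>
    have htop : inductiveSpan d n u = ⊤ :=
      eq_top_iff.mpr fun y _ => mul_one y ▸ ih y 1 one_mem_inductiveSpan
    refine mul_mem_of_generators (fun i hi v hv => ?_) (fun j hj v hv => ?_)
    · obtain rfl | h := eq_or_ne i n
      · exact g_mul_mem htop hv
      · rw [← incl_g i (by omega)]
        exact incl_mul_mem hv _
    · obtain rfl | h := eq_or_ne j (n + 1)
      · exact t_mul_mem hv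
      · rw [← incl_t j (by omega)]
        exact incl_mul_mem hv _

end InductiveSpan

end YokonumaHecke

namespace YokonumaHecke

variable {d n : ℕ} {u : ℂ}

section Steinberg

theorem steinberg_eq_one_add_g_mul (i : ℕ) (hi : i + 2 < n) :
    (steinberg i hi : YokonumaHecke d n u) =
      (1 + g i (by omega)) * (1 + g (i + 1) hi * (1 + g i (by omega))) := by
  rw [steinberg]
  noncomm_ring

theorem steinberg_eq_one_add_g_succ_mul (i : ℕ) (hi : i + 2 < n) :
    (steinberg i hi : YokonumaHecke d n u) =
      (1 + g (i + 1) hi) * (1 + g i (by omega) * (1 + g (i + 1) hi)) := by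
  rw [steinberg, ← g_braid i _ hi]
  noncomm_ring

theorem incl_steinberg (i : ℕ) (hi : i + 2 < n) :
    incl (steinberg i hi : YokonumaHecke d n u) = steinberg i (by omega) := by
  simp only [steinberg, map_add, map_mul, map_one, incl_g]

end Steinberg

section Shift

/-- Conjugation by this element moves the strands `i`, `i + 1`, `i + 2` one step to the right. -/
noncomputable def shift (i : ℕ) (hi : i + 3 < n) : YokonumaHecke d n u :=
  g i (by omega) * g (i + 1) (by omega) * g (i + 2) hi

theorem semiconjBy_shift_t_zero (i : ℕ) (hi : i + 3 < n) :
    SemiconjBy (shift i hi : YokonumaHecke d n u) (t i (by omega)) (t (i + 1) (by omega)) :=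
  ((semiconjBy_g_t_left i _).mul_left (commute_g_t (i + 1) i _ _ (by omega) (by omega))).mul_left
    (commute_g_t (i + 2) i _ _ (by omega) (by omega))

theorem semiconjBy_shift_t_one (i : ℕ) (hi : i + 3 < n) :
    SemiconjBy (shift i hi : YokonumaHecke d n u) (t (i + 1) (by omega)) (t (i + 2) (by omega)) :=
  (SemiconjBy.mul_left (commute_g_t i (i + 2) _ _ (by omega) (by omega))
    (semiconjBy_g_t_left (i + 1) (by omega))).mul_left
    (commute_g_t (i + 2) (i + 1) _ _ (by omega) (by omega))

theorem semiconjBy_shift_t_two (i : ℕ) (hi : i + 3 < n) :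
    SemiconjBy (shift i hi : YokonumaHecke d n u) (t (i + 2) (by omega)) (t (i + 3) hi) :=
  (SemiconjBy.mul_left (commute_g_t i (i + 3) _ _ (by omega) (by omega))
    (commute_g_t (i + 1) (i + 3) _ _ (by omega) (by omega))).mul_left
    (semiconjBy_g_t_left (i + 2) hi)

theorem semiconjBy_g_mul_g_g (i : ℕ) (hi : i + 2 < n) :
    SemiconjBy (g i (by omega) * g (i + 1) hi : YokonumaHecke d n u)
      (g i (by omega)) (g (i + 1) hi) := by
  rw [SemiconjBy, ← mul_assoc, g_braid]

theorem semiconjBy_shift_g (i : ℕ) (hi : i + 3 < n) :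
    SemiconjBy (shift i hi : YokonumaHecke d n u) (g i (by omega)) (g (i + 1) (by omega)) :=
  (semiconjBy_g_mul_g_g i _).mul_left (g_mul_g_comm (i + 2) i _ _ (by omega))

theorem semiconjBy_shift_g_succ (i : ℕ) (hi : i + 3 < n) :
    SemiconjBy (shift i hi : YokonumaHecke d n u) (g (i + 1) (by omega)) (g (i + 2) hi) := by
  rw [shift, mul_assoc]
  exact SemiconjBy.mul_left (g_mul_g_comm i (i + 2) _ _ (by omega))
    (semiconjBy_g_mul_g_g (i + 1) hi)

theorem semiconjBy_shift_steinberg (i : ℕ) (hi : i + 3 < n) :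
    SemiconjBy (shift i hi : YokonumaHecke d n u) (steinberg i (by omega))
      (steinberg (i + 1) hi) := by
  have hA := semiconjBy_shift_g (d := d) (u := u) i hi
  have hB := semiconjBy_shift_g_succ (d := d) (u := u) i hi
  exact (((((SemiconjBy.one_right _).add_right hA).add_right hB).add_right
    (hA.mul_right hB)).add_right (hB.mul_right hA)).add_right ((hA.mul_right hB).mul_right hA)

end Shift

variable [NeZero d]

section Idempotents

/-- The idempotent onto the eigenspace of `t_j` for the eigenvalue `χ(m)`. -/
noncomputable def proj (j : ℕ) (hj : j < n) (m : ZMod d) : YokonumaHecke d n u :=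
  eigenProj (t j hj) m

/-- The idempotent onto the common eigenspace of `t_i` and `t_{i+1}` for the eigenvalue `χ(m)`. -/
noncomputable def pairProj (i : ℕ) (hi : i + 1 < n) (m : ZMod d) : YokonumaHecke d n u :=
  proj i (by omega) m * proj (i + 1) hi m

/-- The idempotent onto the common eigenspace of `t_i`, `t_{i+1}` and `t_{i+2}` for the eigenvalue
`χ(m)`. -/
noncomputable def tripleProj (i : ℕ) (hi : i + 2 < n) (m : ZMod d) : YokonumaHecke d n u :=
  proj i (by omega) m * proj (i + 1) (by omega) m * proj (i + 2) hi m

theorem incl_proj (j : ℕ) (hj : j < n) (m : ZMod d) :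
    incl (proj j hj m : YokonumaHecke d n u) = proj j (by omega) m := by
  rw [proj, map_eigenProj, incl_t, proj]

theorem incl_pairProj (i : ℕ) (hi : i + 1 < n) (m : ZMod d) :
    incl (pairProj i hi m : YokonumaHecke d n u) = pairProj i (by omega) m := by
  rw [pairProj, map_mul, incl_proj, incl_proj, pairProj]

theorem proj_mul_self (j : ℕ) (hj : j < n) (m : ZMod d) :
    (proj j hj m * proj j hj m : YokonumaHecke d n u) = proj j hj m :=
  eigenProj_mul_self (t_pow_d j hj) m

theorem commute_proj_proj (i j : ℕ) (hi : i < n) (hj : j < n) (m m' : ZMod d) :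
    Commute (proj i hi m : YokonumaHecke d n u) (proj j hj m') :=
  commute_eigenProj_eigenProj (commute_t_t i j hi hj) m m'

theorem commute_t_proj (i j : ℕ) (hi : i < n) (hj : j < n) (m : ZMod d) :
    Commute (t i hi : YokonumaHecke d n u) (proj j hj m) :=
  semiconjBy_eigenProj (commute_t_t i j hi hj) m

theorem commute_g_proj (i j : ℕ) (hi : i + 1 < n) (hj : j < n) (h : j ≠ i) (h' : j ≠ i + 1)
    (m : ZMod d) : Commute (g i hi : YokonumaHecke d n u) (proj j hj m) :=
  semiconjBy_eigenProj (commute_g_t i j hi hj h h') m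

theorem semiconjBy_g_proj_left (i : ℕ) (hi : i + 1 < n) (m : ZMod d) :
    SemiconjBy (g i hi : YokonumaHecke d n u) (proj i (by omega) m) (proj (i + 1) hi m) :=
  semiconjBy_eigenProj (semiconjBy_g_t_left i hi) m

theorem semiconjBy_g_proj_right (i : ℕ) (hi : i + 1 < n) (m : ZMod d) :
    SemiconjBy (g i hi : YokonumaHecke d n u) (proj (i + 1) hi m) (proj i (by omega) m) :=
  semiconjBy_eigenProj (semiconjBy_g_t_right i hi) m

theorem t_mul_proj (j : ℕ) (hj : j < n) (m : ZMod d) :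
    (t j hj * proj j hj m : YokonumaHecke d n u) = ZMod.stdAddChar m • proj j hj m :=
  mul_eigenProj (t_pow_d j hj) m

theorem commute_g_pairProj (i : ℕ) (hi : i + 1 < n) (m : ZMod d) :
    Commute (g i hi : YokonumaHecke d n u) (pairProj i hi m) := by
  have h := (semiconjBy_g_proj_left (d := d) (u := u) i hi m).mul_right
    (semiconjBy_g_proj_right i hi m)
  rwa [(commute_proj_proj (i + 1) i _ _ m m).eq] at h

theorem pairProj_mul_t (i : ℕ) (hi : i + 1 < n) (m : ZMod d) :
    (pairProj i hi m * t i (by omega) : YokonumaHecke d n u) = pairProj i hi m * t (i + 1) hi := by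
  rw [pairProj, mul_assoc, mul_assoc, ← (commute_t_proj i (i + 1) _ hi m).eq,
    ← (commute_t_proj (i + 1) (i + 1) hi hi m).eq, t_mul_proj, ← mul_assoc,
    ← (commute_t_proj i i _ _ m).eq, t_mul_proj, smul_mul_assoc, mul_smul_comm]

theorem tripleProj_eq_proj_mul_pairProj_succ (i : ℕ) (hi : i + 2 < n) (m : ZMod d) :
    (tripleProj i hi m : YokonumaHecke d n u) = proj i (by omega) m * pairProj (i + 1) hi m :=
  mul_assoc ..

theorem tripleProj_eq_pairProj_mul_proj (i : ℕ) (hi : i + 2 < n) (m : ZMod d) :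
    (tripleProj i hi m : YokonumaHecke d n u) = pairProj i (by omega) m * proj (i + 2) hi m :=
  rfl

theorem tripleProj_eq_proj_add_two_mul_pairProj (i : ℕ) (hi : i + 2 < n) (m : ZMod d) :
    (tripleProj i hi m : YokonumaHecke d n u) = proj (i + 2) hi m * pairProj i (by omega) m :=
  (((commute_proj_proj (i + 2) i _ _ m m).mul_right (commute_proj_proj (i + 2) (i + 1) _ _ m m)).eq
    ).symm

theorem commute_g_tripleProj (i : ℕ) (hi : i + 2 < n) (m : ZMod d) :
    Commute (g i (by omega) : YokonumaHecke d n u) (tripleProj i hi m) := by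
  rw [tripleProj_eq_proj_add_two_mul_pairProj]
  exact (commute_g_proj i (i + 2) _ hi (by omega) (by omega) m).mul_right
    (commute_g_pairProj i _ m)

theorem commute_g_succ_tripleProj (i : ℕ) (hi : i + 2 < n) (m : ZMod d) :
    Commute (g (i + 1) hi : YokonumaHecke d n u) (tripleProj i hi m) := by
  rw [tripleProj_eq_proj_mul_pairProj_succ]
  exact (commute_g_proj (i + 1) i hi _ (by omega) (by omega) m).mul_right
    (commute_g_pairProj (i + 1) hi m)

theorem t_mul_tripleProj (i j : ℕ) (hi : i + 2 < n) (hij : i ≤ j) (hj : j ≤ i + 2) (m : ZMod d) :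
    (t j (by omega) * tripleProj i hi m : YokonumaHecke d n u) =
      ZMod.stdAddChar m • tripleProj i hi m := by
  have hcomm (k : ℕ) (hk : k < n) := commute_t_proj (d := d) (u := u) j k (by omega) hk m
  obtain rfl | rfl | rfl : j = i ∨ j = i + 1 ∨ j = i + 2 := by omega
  · rw [tripleProj_eq_proj_mul_pairProj_succ, ← mul_assoc, t_mul_proj, smul_mul_assoc]
  · rw [tripleProj_eq_proj_mul_pairProj_succ, (hcomm i _).left_comm, pairProj, ← mul_assoc (t _ _),
      t_mul_proj, smul_mul_assoc, mul_smul_comm]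
  · rw [tripleProj_eq_proj_add_two_mul_pairProj, ← mul_assoc, t_mul_proj, smul_mul_assoc]

theorem pairProj_mul_g_mul_g (i : ℕ) (hi : i + 1 < n) (m : ZMod d) :
    (pairProj i hi m * g i hi * g i hi : YokonumaHecke d n u) =
      u • pairProj i hi m + (u - 1) • (pairProj i hi m * g i hi) :=
  mul_g_mul_g i hi (pairProj_mul_t i hi m)

theorem g_mul_tripleProj_mul_steinberg (i : ℕ) (hi : i + 2 < n) (m : ZMod d) :
    (g i (by omega) * (tripleProj i hi m * steinberg i hi) : YokonumaHecke d n u) =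
      u • (tripleProj i hi m * steinberg i hi) := by
  have hE : (tripleProj i hi m * t i (by omega) : YokonumaHecke d n u) =
      tripleProj i hi m * t (i + 1) (by omega) := by
    rw [tripleProj_eq_proj_add_two_mul_pairProj, mul_assoc, mul_assoc, pairProj_mul_t]
  rw [steinberg_eq_one_add_g_mul, ← mul_assoc (tripleProj _ _ _), ← mul_assoc (g i _),
    mul_mul_one_add (commute_g_tripleProj i hi m).symm (mul_g_mul_g i _ hE), smul_mul_assoc]

theorem g_succ_mul_tripleProj_mul_steinberg (i : ℕ) (hi : i + 2 < n) (m : ZMod d) :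
    (g (i + 1) hi * (tripleProj i hi m * steinberg i hi) : YokonumaHecke d n u) =
      u • (tripleProj i hi m * steinberg i hi) := by
  have hE : (tripleProj i hi m * t (i + 1) (by omega) : YokonumaHecke d n u) =
      tripleProj i hi m * t (i + 1 + 1) hi := by
    rw [tripleProj_eq_proj_mul_pairProj_succ, mul_assoc, mul_assoc, pairProj_mul_t]
  rw [steinberg_eq_one_add_g_succ_mul, ← mul_assoc (tripleProj _ _ _), ← mul_assoc (g (i + 1) _),
    mul_mul_one_add (commute_g_succ_tripleProj i hi m).symm (mul_g_mul_g (i + 1) hi hE),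
    smul_mul_assoc]

theorem exists_mul_tripleProj_mul_steinberg_eq_smul (m : ZMod d) (y : YokonumaHecke d 3 u) :
    ∃ c : ℂ, y * (tripleProj 0 (by omega) m * steinberg 0 (by omega)) =
      c • (tripleProj 0 (by omega) m * steinberg 0 (by omega)) := by
  set v : YokonumaHecke d 3 u := tripleProj 0 (by omega) m * steinberg 0 (by omega)
  have hspan {h : YokonumaHecke d 3 u} {c : ℂ} (hv : h * v = c • v) :
      ∀ w ∈ Submodule.span ℂ {v}, h * w ∈ Submodule.span ℂ {v} := by
    intro w hw
    obtain ⟨b, rfl⟩ := Submodule.mem_span_singleton.mp hw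
    rw [mul_smul_comm, hv]
    exact Submodule.smul_mem _ _ (Submodule.smul_mem _ _ (Submodule.mem_span_singleton_self v))
  have hmem := mul_mem_of_generators (V := Submodule.span ℂ {v}) (fun i hi => ?_) (fun j hj => ?_) y
    v (Submodule.mem_span_singleton_self v)
  · obtain ⟨c, hc⟩ := Submodule.mem_span_singleton.mp hmem
    exact ⟨c, hc.symm⟩
  · obtain rfl | rfl : i = 0 ∨ i = 1 := by omega
    · exact hspan (g_mul_tripleProj_mul_steinberg 0 _ m)
    · exact hspan (g_succ_mul_tripleProj_mul_steinberg 0 _ m)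
  · refine hspan (c := ZMod.stdAddChar m) ?_
    rw [← mul_assoc, t_mul_tripleProj 0 j _ (by omega) (by omega), smul_mul_assoc]

end Idempotents

section ElementR

theorem incl_r (i : ℕ) (hi : i + 2 < n) :
    incl (r i hi : YokonumaHecke d n u) = r i (by omega) := by
  simp only [r, map_sum, apply_ite incl, map_mul, map_pow, incl_t, incl_steinberg, map_zero]

theorem r_eq_sum_tripleProj_mul_steinberg (i : ℕ) (hi : i + 2 < n) :
    (r i hi : YokonumaHecke d n u) =
      (d : ℂ) ^ 2 • ∑ m, tripleProj i hi m * steinberg i hi := by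
  simp only [tripleProj, proj, ← Finset.sum_mul, ← smul_mul_assoc, ← sum_pow_mul_pow_mul_pow]
  simp only [r, Finset.sum_mul, ite_mul, zero_mul]

theorem proj_mul_r (i : ℕ) (hi : i + 2 < n) (m : ZMod d) :
    (proj i (by omega) m * r i hi : YokonumaHecke d n u) =
      (d : ℂ) ^ 2 • (tripleProj i hi m * steinberg i hi) := by
  have horth (m' : ZMod d) : proj i (by omega) m * (tripleProj i hi m' * steinberg i hi) =
      if m = m' then (tripleProj i hi m' * steinberg i hi : YokonumaHecke d n u) else 0 := by
    refine eigenProj_mul_of_mul_eq_smul ?_ m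
    rw [← mul_assoc, t_mul_tripleProj i i hi le_rfl (by omega), smul_mul_assoc]
  simp only [r_eq_sum_tripleProj_mul_steinberg, mul_smul_comm, Finset.mul_sum, horth,
    Finset.sum_ite_eq, Finset.mem_univ, if_true]

theorem r_mem_iff {I : TwoSidedIdeal (YokonumaHecke d n u)} (i : ℕ) (hi : i + 2 < n) :
    r i hi ∈ I ↔ ∀ m, tripleProj i hi m * steinberg i hi ∈ I := by
  have hsmul (c : ℂ) {y : YokonumaHecke d n u} (hy : y ∈ I) : c • y ∈ I := by
    rw [Algebra.smul_def]
    exact I.mul_mem_left _ _ hy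
  constructor
  · intro h m
    have hd : (d : ℂ) ^ 2 ≠ 0 := pow_ne_zero 2 (NeZero.ne _)
    rw [← inv_smul_smul₀ hd (tripleProj i hi m * steinberg i hi), ← proj_mul_r]
    exact hsmul _ (I.mul_mem_left _ _ h)
  · intro h
    rw [r_eq_sum_tripleProj_mul_steinberg]
    exact hsmul _ (sum_mem fun m _ => h m)

end ElementR

section Radical

theorem semiconjBy_shift_r (i : ℕ) (hi : i + 3 < n) :
    SemiconjBy (shift i hi : YokonumaHecke d n u) (r i (by omega)) (r (i + 1) hi) := by
  refine semiconjBy_sum_right _ fun a _ => semiconjBy_sum_right _ fun b _ =>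
    semiconjBy_sum_right _ fun c _ => ?_
  split_ifs
  · exact ((((semiconjBy_shift_t_zero i hi).pow_right _).mul_right
      ((semiconjBy_shift_t_one i hi).pow_right _)).mul_right
      ((semiconjBy_shift_t_two i hi).pow_right _)).mul_right (semiconjBy_shift_steinberg i hi)
  · exact SemiconjBy.zero_right _

theorem isUnit_shift (hu : u ≠ 0) (i : ℕ) (hi : i + 3 < n) :
    IsUnit (shift i hi : YokonumaHecke d n u) :=
  ((isUnit_g hu i _).mul (isUnit_g hu (i + 1) _)).mul (isUnit_g hu (i + 2) hi)

theorem r_mem_of_r_zero_mem (hu : u ≠ 0) {I : TwoSidedIdeal (YokonumaHecke d n u)} {i : ℕ}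
    (hi : i + 2 < n) (h : r 0 (by omega) ∈ I) : r i hi ∈ I := by
  induction i with
  | zero => exact h
  | succ i ih => exact mem_of_semiconjBy (isUnit_shift hu i hi) (semiconjBy_shift_r i hi) (ih _ h)

theorem passesToFTL_iff (hu : u ≠ 0) (hn : 3 ≤ n) {τ : YokonumaHecke d n u →ₗ[ℂ] ℂ} :
    PassesToFTL τ ↔ r 0 (by omega) ∈ kerCore τ := by
  rw [PassesToFTL, exists_linearMap_quotient_iff_le_kerCore, ftlIdeal, TwoSidedIdeal.span_le]
  constructor
  · exact fun h => h ⟨0, by omega, rfl⟩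
  · rintro h _ ⟨i, hi, rfl⟩
    exact r_mem_of_r_zero_mem hu hi h

end Radical

end YokonumaHecke

namespace IsJuyumayaTrace

open YokonumaHecke

variable {d : ℕ} {u z : ℂ} {x : ZMod d → ℂ} {tr : ∀ n : ℕ, YokonumaHecke d n u →ₗ[ℂ] ℂ}

section Reduction

theorem tr_incl_mul_t_pow (htr : IsJuyumayaTrace d u z x tr) (hx : x 0 = 1) (m : ℕ)
    (a : YokonumaHecke d (m + 1) u) (s : ℕ) :
    tr (m + 2) (incl a * t (m + 1) (by omega) ^ s) = x s * tr (m + 1) a := by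
  by_cases hs : (s : ZMod d) = 0
  · obtain ⟨q, rfl⟩ := (ZMod.natCast_eq_zero_iff s d).mp hs
    rw [hs, hx, pow_mul, t_pow_d, one_pow, mul_one, one_mul, htr.compat]
  · rw [← htr.framing m a _ hs, ZMod.val_natCast, ← pow_eq_pow_mod s (t_pow_d _ _)]

theorem exists_tr_incl_mul_eq (htr : IsJuyumayaTrace d u z x tr) (hx : x 0 = 1) {m : ℕ}
    {w : YokonumaHecke d (m + 2) u} (hw : w ∈ lastGens d (m + 1) u) :
    ∃ c : ℂ, ∀ a, tr (m + 2) (incl a * w) = c * tr (m + 1) a := by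
  obtain ⟨s, rfl⟩ | ⟨i, hi, him, rfl⟩ := hw
  · exact ⟨x s, fun a => htr.tr_incl_mul_t_pow hx m a s⟩
  · obtain rfl : i = m := by omega
    exact ⟨z, htr.markov i⟩

theorem incl_mem_kerCore_iff (htr : IsJuyumayaTrace d u z x tr) (hx : x 0 = 1) {m : ℕ}
    {a : YokonumaHecke d (m + 1) u} :
    incl a ∈ kerCore (tr (m + 2)) ↔ a ∈ kerCore (tr (m + 1)) := by
  rw [mem_kerCore_iff_of_trace (htr.trace (m + 1)), mem_kerCore_iff_of_trace (htr.trace m)]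
  refine ⟨fun h b => ?_, fun h y => ?_⟩
  · rw [← htr.compat, map_mul]
    exact h _
  · refine (Submodule.mem_bot ℂ).mp (map_mem_of_mem_inductiveSpan
      (tr (m + 2) ∘ₗ LinearMap.mulRight ℂ (incl a)) (V := ⊥) (fun w hw b c => ?_)
      (inductiveSpan_eq_top ▸ Submodule.mem_top : y ∈ inductiveSpan d (m + 1) u))
    obtain ⟨k, hk⟩ := htr.exists_tr_incl_mul_eq hx hw
    have hcycle : tr (m + 2) (incl b * w * incl c * incl a) = k * tr (m + 1) (b * (c * a)) := by
      rw [mul_assoc (incl b * w), htr.trace, ← map_mul, ← mul_assoc, ← map_mul, hk, htr.trace]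
    rw [Submodule.mem_bot, LinearMap.comp_apply, LinearMap.mulRight_apply, hcycle, ← mul_assoc, h,
      mul_zero]

end Reduction

section ThreeStrands

variable [NeZero d]

theorem tr_incl_mul_proj (htr : IsJuyumayaTrace d u z x tr) (hx : x 0 = 1) (m : ℕ)
    (a : YokonumaHecke d (m + 1) u) (k : ZMod d) :
    tr (m + 2) (incl a * proj (m + 1) (by omega) k) = dftCoeff x k * tr (m + 1) a := by
  refine (map_dftCoeff (tr (m + 2) ∘ₗ LinearMap.mulLeft ℂ (incl a)) _ k).trans ?_
  refine Eq.trans ?_ (map_dftCoeff (LinearMap.mulRight ℂ (tr (m + 1) a)) x k).symm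
  simp only [LinearMap.comp_apply, LinearMap.mulLeft_apply, LinearMap.mulRight_apply,
    htr.tr_incl_mul_t_pow hx, ZMod.natCast_zmod_val]

theorem tr_incl_mul_proj_mul_g (htr : IsJuyumayaTrace d u z x tr) (m : ℕ)
    (a : YokonumaHecke d (m + 1) u) (k : ZMod d) :
    tr (m + 2) (incl a * proj (m + 1) (by omega) k * g m (by omega)) =
      z * tr (m + 1) (a * proj m (by omega) k) := by
  rw [mul_assoc, ← (semiconjBy_g_proj_left m _ k).eq, ← mul_assoc, htr.trace, ← mul_assoc,
    ← incl_proj m, ← map_mul, htr.markov, htr.trace]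

theorem tr_proj_zero (htr : IsJuyumayaTrace d u z x tr) (hx : x 0 = 1) (hu : u ≠ 0) (k : ZMod d) :
    tr 1 (proj 0 one_pos k) = dftCoeff x k := by
  rw [← htr.compat, incl_proj, trace_eq_of_semiconjBy (htr.trace 1) (isUnit_g hu 0 _)
    (semiconjBy_g_proj_left 0 one_lt_two k)]
  simpa only [map_one, one_mul, htr.unit, mul_one] using htr.tr_incl_mul_proj hx 0 1 k

theorem tr_pairProj_mul_one_add_g (htr : IsJuyumayaTrace d u z x tr) (hx : x 0 = 1) (hu : u ≠ 0)
    (k : ZMod d) :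
    tr 2 (pairProj 0 one_lt_two k * (1 + g 0 one_lt_two)) =
      dftCoeff x k * (dftCoeff x k + z) := by
  rw [pairProj, ← incl_proj 0 one_pos, mul_add, mul_one, map_add, htr.tr_incl_mul_proj hx,
    htr.tr_incl_mul_proj_mul_g, proj_mul_self, htr.tr_proj_zero hx hu]
  ring

theorem tr_tripleProj_mul_steinberg (htr : IsJuyumayaTrace d u z x tr) (hx : x 0 = 1)
    (hu : u ≠ 0) (k : ZMod d) :
    tr 3 (tripleProj 0 (by omega) k * steinberg 0 (by omega)) =
      dftCoeff x k * (dftCoeff x k + z) * (dftCoeff x k + (u + 1) * z) := by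
  set T : YokonumaHecke d 2 u := 1 + g 0 one_lt_two with hT
  set c : YokonumaHecke d 2 u := pairProj 0 one_lt_two k * T with hc
  have hincl : (1 + g 0 (by omega) : YokonumaHecke d 3 u) = incl T := by
    rw [hT, map_add, map_one, incl_g]
  have hfactor : tripleProj 0 (by omega) k * incl T = incl c * proj 2 (by omega) k := by
    have hcomm : Commute (incl T) (proj 2 (by omega) k) := hincl ▸
      (Commute.one_left _).add_left (commute_g_proj 0 2 _ _ (by omega) (by omega) k)
    rw [tripleProj_eq_pairProj_mul_proj, mul_assoc, ← hcomm.eq, ← mul_assoc, ← incl_pairProj,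
      ← map_mul]
  have habsorb : T * c * proj 1 one_lt_two k = (u + 1) • c := by
    have hcomm : Commute T (pairProj 0 one_lt_two k) :=
      (Commute.one_left _).add_left (commute_g_pairProj 0 one_lt_two k)
    rw [hc, ← mul_assoc, hcomm.eq, mul_one_add_mul_one_add (pairProj_mul_g_mul_g 0 one_lt_two k),
      smul_mul_assoc, ← hT, ← hcomm.eq, mul_assoc, pairProj, mul_assoc, proj_mul_self]
  calc tr 3 (tripleProj 0 (by omega) k * steinberg 0 (by omega))
      = tr 3 (incl c * proj 2 (by omega) k) +
          tr 3 (incl c * proj 2 (by omega) k * g 1 (by omega) * incl T) := by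
        rw [steinberg_eq_one_add_g_mul, hincl, ← mul_assoc, hfactor, mul_add, mul_one, map_add,
          ← mul_assoc]
    _ = dftCoeff x k * tr 2 c + z * tr 2 (T * c * proj 1 one_lt_two k) := by
        rw [htr.trace 2 _ (incl T), ← mul_assoc, ← mul_assoc, ← map_mul, htr.tr_incl_mul_proj_mul_g,
          htr.tr_incl_mul_proj hx]
    _ = _ := by
        rw [habsorb, map_smul, hc, htr.tr_pairProj_mul_one_add_g hx hu, smul_eq_mul]
        ring

theorem r_zero_mem_kerCore_three_iff (htr : IsJuyumayaTrace d u z x tr) (hx : x 0 = 1)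
    (hu : u ≠ 0) :
    r 0 (by omega) ∈ kerCore (tr 3) ↔
      ∀ m, dftCoeff x m * (dftCoeff x m + z) * (dftCoeff x m + (u + 1) * z) = 0 := by
  rw [r_mem_iff]
  refine forall_congr' fun m => ?_
  rw [← htr.tr_tripleProj_mul_steinberg hx hu, mem_kerCore_iff_of_trace (htr.trace 2)]
  refine ⟨fun h => by simpa only [one_mul] using h 1, fun h y => ?_⟩
  obtain ⟨c, hc⟩ := exists_mul_tripleProj_mul_steinberg_eq_smul m y
  rw [hc, map_smul, h, smul_zero]

theorem r_zero_mem_kerCore_iff (htr : IsJuyumayaTrace d u z x tr) (hx : x 0 = 1) {n : ℕ}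
    (hn : 3 ≤ n) : r 0 (by omega) ∈ kerCore (tr n) ↔ r 0 (by omega) ∈ kerCore (tr 3) := by
  induction n, hn using Nat.le_induction with
  | base => rfl
  | succ n hn ih =>
    obtain ⟨m, rfl⟩ := Nat.exists_eq_succ_of_ne_zero (show n ≠ 0 by omega)
    rw [← incl_r 0 hn]
    exact (htr.incl_mem_kerCore_iff hx).trans ih

end ThreeStrands

end IsJuyumayaTrace

theorem theorem6 (d n : ℕ) [NeZero d] (hn : 3 ≤ n) (u : ℂ) (hu : u ≠ 0)
    (z : ℂ) (x : ZMod d → ℂ) (hx : x 0 = 1)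
    (tr : ∀ k : ℕ, YokonumaHecke d k u →ₗ[ℂ] ℂ) (htr : IsJuyumayaTrace d u z x tr) :
    PassesToFTL (tr n) ↔
      ∃ Sup₁ Sup₂ : Finset (ZMod d),
        Disjoint Sup₁ Sup₂ ∧
        ((Sup₁ ∪ Sup₂ : Finset (ZMod d)) : Set (ZMod d)) = Function.support (ZMod.dft x) ∧
        (∀ k : ZMod d, x k = -z * (∑ m ∈ Sup₁, ZMod.stdAddChar (k * m) +
          (u + 1) * ∑ m ∈ Sup₂, ZMod.stdAddChar (k * m))) ∧
        (Sup₁.card : ℂ) + (u + 1) * (Sup₂.card : ℂ) ≠ 0 ∧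
        z = -1 / ((Sup₁.card : ℂ) + (u + 1) * (Sup₂.card : ℂ)) := by
  rw [YokonumaHecke.passesToFTL_iff hu hn, htr.r_zero_mem_kerCore_iff hx hn,
    htr.r_zero_mem_kerCore_three_iff hx hu, forall_mul_add_mul_add_eq_zero_iff, support_dftCoeff]
  refine exists₂_congr fun S₁ S₂ => and_congr_right' <| and_congr_right' ?_
  rw [dftCoeff_eq_ite_add_ite_iff, ← neg_mul_eq_one_iff]
  exact (and_iff_left_of_imp (neg_mul_card_add_card_eq_one hx)).symm
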